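/- \textbf{Setting.} Let $K\ge 1$ and $n\ge 0$ be integers and $N=2^n$. For $h:\{0,1\}^n\to\{\pm1\}$ put $|\psi_h\rangle=N^{-1/2}\sum_{x}h(x)|x\rangle$. An \emph{oracle circuit} $A^{(\cdot)}$ with an $n$-qubit input register consists of integers $a,\ell,t\ge 0$ with $m:=n+a\ge 1$ and $\ell\le m$, and of $m$-qubit unitaries $U_1,\dots,U_{t+1}$. For an oracle $f:\{0,1\}^\ell\to\{\pm1\}$ let $\mathcal O_f$ be the phase oracle $|y\rangle\mapsto f(y)|y\rangle$, applied to the first $\ell$ qubits; then $A^f$ denotes the operation $$|\psi\rangle\;\longmapsto\; U_{t+1}\,\mathcal O_f\,U_t\cdots \mathcal O_f\,U_2\,\mathcal O_f\,U_1\,\bigl(|\psi\rangle\otimes|0^a\rangle\bigr)$$ on $n$-qubit states. The circuit is \emph{$S$-small} if the number of distinct $A^f$, over all oracles $f$, is at most $S$ (this holds in particular if there are at most $S$ distinct $m$-qubit unitaries $U_{t+1}\mathcal O_f U_t\cdots\mathcal O_f U_1$). \textbf{Game.} For $R:[K]\times\{0,1\}^n\to\{\pm1\}$, with $R_k=R(k,\cdot)$,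 the adversary $A^f$ receives with probability $\tfrac12$ ($b=0$) the state $|\psi_{R_k}\rangle$ for uniform $k\in[K]$, and with probability $\tfrac12$ ($b=1$) the basis state $|x\rangle$ for uniform $x\in\{0,1\}^n$. It applies $A^f$, measures the first qubit in the standard basis, and wins if the outcome equals $b$. Its advantage is $\Delta_A(R\mid f)=2\,\bigl|\Pr[A^f\text{ wins}]-\tfrac12\bigr|$, and $\Delta_A(R)=\max_{f:\{0,1\}^\ell\to\{\pm1\}}\Delta_A(R\mid f)$. \textbf{Theorem (Counting bound).} There is a universal constant $c>0$ such that for all integers $K\ge1$ and $n\ge 0$, all real $\varepsilon\ge 0$ and every oracle circuit $A^{(\cdot)}$ with an $n$-qubit input register, with $N=2^n$ and $S=\exp(c\,\varepsilon^2KN)$: \begin{enumerate} \item If $A^{(\cdot)}$ is $S$-small, then for a uniformly random $R:[K]\times\{0,1\}^n\to\{\pm1\}$, $$\Pr_{R}\bigl[\Delta_A(R)\ge\varepsilon\bigr]\;\le\;2\exp(-c\,\varepsilon^2KN).$$ \item (Aaronson--Kuperberg-type adversaries.) The same bound holds if, for every oracle $f$, the circuit exactly computes a unitary on its first $n$ qubits,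 i.e. $A^f|\psi\rangle=(V_f|\psi\rangle)\otimes|\mathrm{junk}_f\rangle$ for all $|\psi\rangle$, with $V_f$ an $n$-qubit unitary and $|\mathrm{junk}_f\rangle$ an $a$-qubit state, and the number of distinct $V_f$ is at most $S$. \item (Small-ancilla adversaries.) $A^{(\cdot)}$ is always $2^{M}$-small, where $M=2^{m}=2^{n+a}$, so that the bound in (1) holds whenever $2^{M}\le S$. \end{enumerate} -/

import Mathlib

open scoped BigOperators Matrix

noncomputable section

/-- The computational basis of a register of `m` qubits. -/
abbrev Bits (m : ℕ) : Type := Fin m → Bool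

/-- Functions from `ℓ`-bit strings to `{1, -1}` (the units of `ℤ`). -/
abbrev BoolFn (ℓ : ℕ) : Type := Bits ℓ → ℤˣ

/-- Families `R_1, …, R_K` of functions from `n`-bit strings to `{1, -1}`. -/
abbrev FnFamily (K n : ℕ) : Type := Fin K → BoolFn n

/-- The binary phase state `N^(-1/2) ∑_x h(x) |x⟩`, where `N = 2^n`. -/
def phaseState {n : ℕ} (h : BoolFn n) : Bits n → ℂ :=
  fun x => ((1 / Real.sqrt ((2 : ℝ) ^ n) : ℝ) : ℂ) * (((h x : ℤˣ) : ℤ) : ℂ)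

/-- An oracle circuit with an `n`-qubit input register and `a` ancilla qubits. It makes `t` queries
to a phase oracle of input length `ℓ` acting on the first `ℓ` qubits; `U 0, …, U t` are the
unitaries applied before, between and after the queries. There is at least one qubit, as
the first qubit is going to be measured. -/
structure OracleCircuit (n : ℕ) where
  a : ℕ
  ℓ : ℕ
  t : ℕ
  query_le : ℓ ≤ n + a
  size_pos : 0 < n + a
  U : Fin (t + 1) → Matrix.unitaryGroup (Bits (n + a)) ℂ

namespace OracleCircuit

variable {n : ℕ} (A : OracleCircuit n)

/-- The oracles that the circuit may query. -/
abbrev Oracle : Type := BoolFn A.ℓ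

/-- The phase oracle `O_f ⊗ Id`, acting on the first `ℓ` of all `n + a` qubits. -/
def phaseOracle (f : A.Oracle) : Matrix (Bits (n + A.a)) (Bits (n + A.a)) ℂ :=
  Matrix.diagonal fun y => (((f fun i => y (Fin.castLE A.query_le i) : ℤˣ) : ℤ) : ℂ)

/-- The product `U_{t+1} O_f U_t ⋯ O_f U_2 O_f U_1` on all `n + a` qubits. -/
def fullOp (f : A.Oracle) : Matrix (Bits (n + A.a)) (Bits (n + A.a)) ℂ :=
  (A.U (Fin.last A.t) : Matrix (Bits (n + A.a)) (Bits (n + A.a)) ℂ) *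
    (List.ofFn fun i : Fin A.t =>
      A.phaseOracle f *
        (A.U i.castSucc : Matrix (Bits (n + A.a)) (Bits (n + A.a)) ℂ)).reverse.prod

/-- The map `|ψ⟩ ↦ |ψ⟩ ⊗ |0^a⟩`. -/
def ancillaInit : Matrix (Bits (n + A.a)) (Bits n) ℂ :=
  Matrix.of fun y x => if y = Fin.append x (fun _ => false) then 1 else 0

/-- The operation `A^f` computed by the circuit on its `n`-qubit inputs:
`|ψ⟩ ↦ U_{t+1} O_f U_t ⋯ O_f U_1 (|ψ⟩ ⊗ |0^a⟩)`. -/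
def run (f : A.Oracle) : Matrix (Bits (n + A.a)) (Bits n) ℂ :=
  A.fullOp f * A.ancillaInit

/-- The circuit is `S`-small: over all oracles `f`, it realizes at most `S` distinct `A^f`. -/
def IsSmall (S : ℝ) : Prop :=
  ((Set.range A.run).ncard : ℝ) ≤ S

/-- `S`-smallness may be checked on the unitaries `U_{t+1} O_f U_t ⋯ O_f U_1`
of the whole register. -/
theorem isSmall_of_fullOp {S : ℝ} (h : ((Set.range A.fullOp).ncard : ℝ) ≤ S) : A.IsSmall S := by
  have e : Set.range A.run = (fun X => X * A.ancillaInit) '' Set.range A.fullOp := by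
    rw [← Set.range_comp]; rfl
  refine le_trans ?_ h
  rw [e]
  exact_mod_cast Set.ncard_image_le (Set.finite_range A.fullOp)

/-- For every oracle `f`, the circuit exactly computes a unitary `V f` on its first `n` qubits, that
is, `A^f |ψ⟩ = (V f |ψ⟩) ⊗ |junk f⟩` for all `|ψ⟩`, and there are at most `S` distinct `V f`. -/
def ExactlyComputesAtMost (S : ℝ) : Prop :=
  ∃ (V : A.Oracle → Matrix.unitaryGroup (Bits n) ℂ) (junk : A.Oracle → Bits A.a → ℂ),
    (∀ f (ψ : Bits n → ℂ) (x : Bits n) (z : Bits A.a),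
      (A.run f *ᵥ ψ) (Fin.append x z) =
        ((V f : Matrix (Bits n) (Bits n) ℂ) *ᵥ ψ) x * junk f z) ∧
    ((Set.range V).ncard : ℝ) ≤ S

/-- The probability that measuring the first qubit of `A^f |ψ⟩` in the standard basis gives `b`. -/
def outProb (f : A.Oracle) (ψ : Bits n → ℂ) (b : Bool) : ℝ :=
  ∑ y : Bits (n + A.a), if y ⟨0, A.size_pos⟩ = b then ‖(A.run f *ᵥ ψ) y‖ ^ 2 else 0

/-- The probability that `A^f` wins the game on `R`: with probability `1/2` the adversary is
given `|ψ_{R_k}⟩` for a uniform `k` and has to output `0` (`false`), with probability `1/2` it is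
given `|x⟩` for a uniform `x` and has to output `1` (`true`). -/
def winProb {K : ℕ} (R : FnFamily K n) (f : A.Oracle) : ℝ :=
  1 / 2 * (𝔼 k : Fin K, A.outProb f (phaseState (R k)) false) +
    1 / 2 * (𝔼 x : Bits n, A.outProb f (Pi.single x 1) true)

/-- The distinguishing advantage of `A^f` on `R`. -/
def advantage {K : ℕ} (R : FnFamily K n) (f : A.Oracle) : ℝ :=
  2 * |A.winProb R f - 1 / 2|

/-- The maximum distinguishing advantage of the adversary on `R`, over all oracles `f`. -/
def maxAdvantage {K : ℕ} (R : FnFamily K n) : ℝ :=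
  Finset.univ.sup' Finset.univ_nonempty fun f : A.Oracle => A.advantage R f

open Classical in
/-- The probability, over a uniformly random family `R`, that the maximum distinguishing advantage
is at least `ε`: the proportion of such `R` among all families. -/
def probAdvantageGE (K : ℕ) (ε : ℝ) : ℝ :=
  (((Finset.univ.filter fun R : FnFamily K n => ε ≤ A.maxAdvantage R).dens : ℚ≥0) : ℝ)

end OracleCircuit

end

/-! Phase states and basis states are real vectors, so only the real part `Q` of the operator for
outcome 0, pulled back to the input qubits, matters, and `0 ≤ Q ≤ 1`. A uniform basis state gives
outcome 0 with probability `tr Q / N`, which is also the mean of `r ⬝ᵥ Q *ᵥ r / N` over random signs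
`r`. The advantage is thus the absolute value of an average of `K` independent centered quadratic
forms (`advantage_eq`).

Diagonalizing `Q` and linearizing each square by an auxiliary Gaussian, `exp (a s²) = E exp (√(2a) s
g)`, bounds the exponential moment by its Gaussian analogue (`sum_exp_sq_signVec_le`). Markov's
inequality then gives a tail `2 exp (-ε²KN/16)` for each fixed oracle
(`card_le_abs_sum_quadForm_signVec`), and a union bound over the at most `S` relevant behaviours
costs only half of that exponent (`probAdvantageGE_le`). -/

noncomputable section

/-! ### Exponential moments and tails of quadratic forms in random signs. -/

section RademacherChaos

open MeasureTheory ProbabilityTheory Real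

/-- A sign function as a real vector. -/
def signVec {ι : Type*} (r : ι → ℤˣ) : ι → ℝ := fun x => ((r x : ℤ) : ℝ)

theorem signVec_mul_self {ι : Type*} (r : ι → ℤˣ) (x : ι) : signVec r x * signVec r x = 1 := by
  rcases Int.units_eq_one_or (r x) with h | h <;> simp [signVec, h]

theorem gaussian_integral_exp_mul (s : ℝ) :
    ∫ g, exp (s * g) ∂gaussianReal 0 1 = exp (s ^ 2 / 2) := by
  simpa [mgf] using congrFun (mgf_id_gaussianReal (μ := 0) (v := 1)) s

theorem gaussian_integrable_exp_sq {a : ℝ} (ha : a < 1 / 2) :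
    Integrable (fun g => exp (a * g ^ 2)) (gaussianReal 0 1) := by
  rw [gaussianReal_of_var_ne_zero _ one_ne_zero,
    integrable_withDensity_iff (by fun_prop) (by simp [gaussianPDF])]
  simp only [toReal_gaussianPDF]
  have h := (integrable_exp_neg_mul_sq (b := 1 / 2 - a) (by linarith)).const_mul (√(2 * π))⁻¹
  refine h.congr (Filter.Eventually.of_forall fun g => ?_)
  simp only [gaussianPDFReal_def, NNReal.coe_one, mul_one, sub_zero]
  rw [mul_left_comm, ← exp_add]
  ring_nf

theorem gaussian_integral_exp_sq {a : ℝ} (ha : a < 1 / 2) :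
    ∫ g, exp (a * g ^ 2) ∂gaussianReal 0 1 = (√(1 - 2 * a))⁻¹ := by
  rw [integral_gaussianReal_eq_integral_smul one_ne_zero]
  have : ∀ g : ℝ, gaussianPDFReal 0 1 g • exp (a * g ^ 2)
      = (√(2 * π))⁻¹ * exp (-(1 / 2 - a) * g ^ 2) := fun g => by
    simp only [gaussianPDFReal_def, NNReal.coe_one, mul_one, sub_zero, smul_eq_mul]
    rw [mul_assoc, ← exp_add]
    ring_nf
  simp_rw [this]
  rw [integral_const_mul, integral_gaussian, ← sqrt_inv, ← sqrt_inv, ← sqrt_mul (by positivity)]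
  congr 1
  have h1 : 1 - 2 * a ≠ 0 := by linarith
  have h2 : 1 / 2 - a ≠ 0 := by linarith
  field_simp

/-- First-order expansion of `log (1 - x)` at `x = 2a`: as `x ≤ 1/2`, the remainder `x² / (1 - x)`
is at most `8a²`, and the square root halves it. -/
theorem inv_sqrt_one_sub_le {a : ℝ} (h0 : 0 ≤ a) (h : a ≤ 1 / 4) :
    (√(1 - 2 * a))⁻¹ ≤ exp (a + 4 * a ^ 2) := by
  have hlog := abs_log_sub_add_sum_range_le (x := 2 * a)
    (by rw [abs_of_nonneg (by linarith)]; linarith) 1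
  rw [abs_of_nonneg (by linarith : (0 : ℝ) ≤ 2 * a)] at hlog
  have hdiv : (2 * a) ^ (1 + 1) / (1 - 2 * a) ≤ 8 * a ^ 2 := by
    rw [div_le_iff₀ (by linarith), show (2 * a) ^ (1 + 1) = 4 * a ^ 2 by ring]
    nlinarith [mul_nonneg (sq_nonneg a) (sub_nonneg.mpr h)]
  have h2 := (abs_le.mp (hlog.trans hdiv)).1
  simp only [Finset.range_one, Finset.sum_singleton] at h2
  norm_num at h2
  have hpos : 0 < 1 - 2 * a := by linarith
  rw [← exp_log (inv_pos.mpr (sqrt_pos.mpr hpos)), log_inv, log_sqrt hpos.le]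
  exact exp_le_exp.mpr (by linarith)

variable {ι κ : Type*} [Fintype ι] [DecidableEq ι]

/-- The coordinates are independent, so the sum factors into terms `2 cosh (b x)`, and `cosh y ≤ exp
(y²/2)`. -/
theorem sum_exp_dotProduct_signVec_le (b : ι → ℝ) :
    ∑ r : ι → ℤˣ, exp (b ⬝ᵥ signVec r) ≤ 2 ^ Fintype.card ι * exp (b ⬝ᵥ b / 2) := by
  have h := Finset.sum_prod_piFinset (Finset.univ : Finset ℤˣ)
    fun (x : ι) (s : ℤˣ) => exp (b x * ((s : ℤ) : ℝ))
  rw [Fintype.piFinset_univ] at h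
  have h2 : ∀ r : ι → ℤˣ, exp (b ⬝ᵥ signVec r) = ∏ x, exp (b x * ((r x : ℤ) : ℝ)) := fun r => by
    rw [← exp_sum]; rfl
  simp_rw [h2]
  rw [h]
  have h3 : ∀ x, ∑ s : ℤˣ, exp (b x * ((s : ℤ) : ℝ)) = 2 * cosh (b x) := fun x => by
    simp [cosh_eq, UnitsInt.univ]
    ring
  calc ∏ x, ∑ s : ℤˣ, exp (b x * ((s : ℤ) : ℝ)) ≤ ∏ x, 2 * exp (b x ^ 2 / 2) := by
        refine Finset.prod_le_prod (fun x _ => Finset.sum_nonneg fun _ _ => (exp_pos _).le)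
          fun x _ => ?_
        rw [h3]
        gcongr
        exact cosh_le_exp_half_sq _
    _ = 2 ^ Fintype.card ι * exp (b ⬝ᵥ b / 2) := by
        rw [Finset.prod_mul_distrib, ← exp_sum, Finset.prod_const, Finset.card_univ]
        simp only [dotProduct, Finset.sum_div, sq]

/-- The exponential moment of a sum of squares of orthonormal linear forms in random signs is at
most the corresponding Gaussian one. -/
theorem sum_exp_sq_signVec_le [DecidableEq κ] (u : κ → ι → ℝ) (a : κ → ℝ) (ha : ∀ j, 0 ≤ a j)
    (ha' : ∀ j, a j < 1 / 2) (hu : ∀ i j, u i ⬝ᵥ u j = if i = j then 1 else 0) (s : Finset κ) :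
    ∀ b : ι → ℝ, (∀ j ∈ s, b ⬝ᵥ u j = 0) →
    ∑ r : ι → ℤˣ, exp (∑ j ∈ s, a j * (u j ⬝ᵥ signVec r) ^ 2 + b ⬝ᵥ signVec r) ≤
      2 ^ Fintype.card ι * (∏ j ∈ s, (√(1 - 2 * a j))⁻¹) * exp (b ⬝ᵥ b / 2) := by
  induction s using Finset.induction_on with
  | empty => intro b _; simpa using sum_exp_dotProduct_signVec_le b
  | insert i s hi ih =>
    intro b hb
    -- With this `c`, averaging `exp (c s g)` over a standard Gaussian `g` gives `exp (a i * s²)`.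
    set c := √(2 * a i) with hc
    have hc2 : c ^ 2 = 2 * a i := sq_sqrt (by linarith [ha i])
    -- For fixed `g` the linearized square is absorbed into `b`, which stays orthogonal to the
    -- remaining `u j`; this is why the induction carries a general `b`.
    let F : (ι → ℤˣ) → ℝ → ℝ := fun r g =>
      exp (∑ j ∈ s, a j * (u j ⬝ᵥ signVec r) ^ 2 + (b + (c * g) • u i) ⬝ᵥ signVec r)
    have hF : ∀ r g, F r g = exp (∑ j ∈ s, a j * (u j ⬝ᵥ signVec r) ^ 2 + b ⬝ᵥ signVec r) *
        exp (c * (u i ⬝ᵥ signVec r) * g) := fun r g => by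
      simp only [F, add_dotProduct, smul_dotProduct, smul_eq_mul]
      rw [← exp_add]
      ring_nf
    have hFint : ∀ r, Integrable (F r) (gaussianReal 0 1) := fun r => by
      simp_rw [funext (hF r)]
      exact (integrable_exp_mul_gaussianReal _).const_mul _
    have hterm : ∀ r : ι → ℤˣ,
        exp (∑ j ∈ insert i s, a j * (u j ⬝ᵥ signVec r) ^ 2 + b ⬝ᵥ signVec r) =
          ∫ g, F r g ∂gaussianReal 0 1 := fun r => by
      simp_rw [hF]
      rw [integral_const_mul, gaussian_integral_exp_mul, ← exp_add, Finset.sum_insert hi, mul_pow,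
        hc2]
      ring_nf
    simp_rw [hterm]
    rw [← integral_finsetSum _ fun r _ => hFint r]
    have hnorm : ∀ g : ℝ, (b + (c * g) • u i) ⬝ᵥ (b + (c * g) • u i) / 2 =
        b ⬝ᵥ b / 2 + a i * g ^ 2 := fun g => by
      have h1 : b ⬝ᵥ u i = 0 := hb i (Finset.mem_insert_self i s)
      have h2 : u i ⬝ᵥ b = 0 := by rw [dotProduct_comm, h1]
      simp only [add_dotProduct, dotProduct_add, smul_dotProduct, dotProduct_smul, smul_eq_mul,
        h1, h2, hu, if_true]
      linear_combination g ^ 2 / 2 * hc2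
    have hle : ∀ g, ∑ r, F r g ≤ 2 ^ Fintype.card ι * (∏ j ∈ s, (√(1 - 2 * a j))⁻¹) *
        exp (b ⬝ᵥ b / 2) * exp (a i * g ^ 2) := fun g => by
      have := ih (b + (c * g) • u i) fun j hj => by
        have hij : i ≠ j := fun h => hi (h ▸ hj)
        simp [add_dotProduct, smul_dotProduct, hb j (Finset.mem_insert_of_mem hj), hu, hij]
      rwa [hnorm, exp_add, ← mul_assoc] at this
    refine (integral_mono (integrable_finsetSum _ fun r _ => hFint r)
      ((gaussian_integrable_exp_sq (ha' i)).const_mul _) hle).trans_eq ?_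
    rw [integral_const_mul, gaussian_integral_exp_sq (ha' i), Finset.prod_insert hi]
    ring

/-- Exponential moments of a Rademacher chaos of order two. -/
theorem sum_exp_quadForm_signVec_le (Q : Matrix ι ι ℝ) (hQ : Q.IsHermitian)
    (h0 : ∀ v, 0 ≤ v ⬝ᵥ Q *ᵥ v) (h1 : ∀ v, v ⬝ᵥ Q *ᵥ v ≤ v ⬝ᵥ v) {t : ℝ} (ht : 0 ≤ t)
    (ht' : t ≤ 1 / 4) :
    ∑ r : ι → ℤˣ, exp (t * (signVec r ⬝ᵥ Q *ᵥ signVec r - Q.trace)) ≤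
      2 ^ Fintype.card ι * exp (4 * t ^ 2 * Fintype.card ι) := by
  let u : ι → ι → ℝ := fun j => ⇑(hQ.eigenvectorBasis j)
  have hu : ∀ i j, u i ⬝ᵥ u j = if i = j then 1 else 0 := fun i j => by
    rw [← orthonormal_iff_ite.mp hQ.eigenvectorBasis.orthonormal i j,
      EuclideanSpace.inner_eq_star_dotProduct, dotProduct_comm]
    rfl
  have hev : ∀ j, Q *ᵥ u j = hQ.eigenvalues j • u j := hQ.mulVec_eigenvectorBasis
  have hm0 : ∀ j, 0 ≤ hQ.eigenvalues j := fun j => by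
    simpa [hev, hu] using h0 (u j)
  have hm1 : ∀ j, hQ.eigenvalues j ≤ 1 := fun j => by
    simpa [hev, hu] using h1 (u j)
  have hquad : ∀ v : ι → ℝ, v ⬝ᵥ Q *ᵥ v = ∑ j, hQ.eigenvalues j * (u j ⬝ᵥ v) ^ 2 := fun v => by
    have hsum : v = ∑ j, (u j ⬝ᵥ v) • u j := by
      have h := congrArg WithLp.ofLp (hQ.eigenvectorBasis.sum_repr' (WithLp.toLp 2 v))
      rw [WithLp.ofLp_sum] at h
      refine h.symm.trans (Finset.sum_congr rfl fun j _ => ?_)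
      rw [WithLp.ofLp_smul, EuclideanSpace.inner_eq_star_dotProduct, dotProduct_comm]
      rfl
    have hQv : Q *ᵥ v = ∑ j, (u j ⬝ᵥ v) • hQ.eigenvalues j • u j := by
      conv_lhs => rw [hsum]
      rw [Matrix.mulVec_sum]
      simp_rw [Matrix.mulVec_smul, hev]
    rw [hQv, dotProduct_sum]
    refine Finset.sum_congr rfl fun j _ => ?_
    rw [dotProduct_smul, dotProduct_smul, dotProduct_comm v, smul_eq_mul, smul_eq_mul]
    ring
  have htr : Q.trace = ∑ j, hQ.eigenvalues j := by
    simpa using hQ.trace_eq_sum_eigenvalues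
  have htm : ∀ j, t * hQ.eigenvalues j ≤ t := fun j => by nlinarith [hm1 j]
  have key := sum_exp_sq_signVec_le u (fun j => t * hQ.eigenvalues j)
    (fun j => mul_nonneg ht (hm0 j)) (fun j => by linarith [htm j]) hu Finset.univ 0 (by simp)
  simp only [zero_dotProduct, add_zero, zero_div, exp_zero, mul_one] at key
  have hprod : ∏ j, (√(1 - 2 * (t * hQ.eigenvalues j)))⁻¹ ≤
      exp (t * Q.trace) * exp (4 * t ^ 2 * Fintype.card ι) := by
    -- The first-order terms add up to `t * Q.trace`, which the centering cancels; eigenvalues at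
    -- most 1 control the second-order ones.
    calc _ ≤ ∏ j, exp (t * hQ.eigenvalues j + 4 * t ^ 2) := by
          refine Finset.prod_le_prod (fun j _ => by positivity) fun j _ => ?_
          refine (inv_sqrt_one_sub_le (mul_nonneg ht (hm0 j)) ((htm j).trans ht')).trans
            (exp_le_exp.mpr ?_)
          have := pow_le_pow_left₀ (mul_nonneg ht (hm0 j)) (htm j) 2
          linarith
      _ = _ := by
          rw [← exp_sum, ← exp_add, Finset.sum_add_distrib, htr, Finset.mul_sum]
          simp [mul_comm]
  have hrw : ∀ r : ι → ℤˣ, exp (t * (signVec r ⬝ᵥ Q *ᵥ signVec r - Q.trace)) =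
      exp (∑ j, t * hQ.eigenvalues j * (u j ⬝ᵥ signVec r) ^ 2) * exp (-(t * Q.trace)) := fun r => by
    rw [← exp_add, hquad, mul_sub, Finset.mul_sum]
    simp_rw [mul_assoc]
    rfl
  simp_rw [hrw]
  rw [← Finset.sum_mul]
  calc _ ≤ 2 ^ Fintype.card ι * (exp (t * Q.trace) * exp (4 * t ^ 2 * Fintype.card ι)) *
        exp (-(t * Q.trace)) := by
        gcongr
        exact key.trans (by gcongr)
    _ = _ := by
        rw [exp_neg]
        field_simp

/-- Upper tail of the sum of `K` independent copies of a Rademacher chaos. -/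
theorem card_le_sum_quadForm_signVec (K : ℕ) (Q : Matrix ι ι ℝ) (hQ : Q.IsHermitian)
    (h0 : ∀ v, 0 ≤ v ⬝ᵥ Q *ᵥ v) (h1 : ∀ v, v ⬝ᵥ Q *ᵥ v ≤ v ⬝ᵥ v) {ε : ℝ} (hε : 0 ≤ ε)
    (hε' : ε ≤ 1) (T : Finset (Fin K → ι → ℤˣ))
    (hT : ∀ R ∈ T, ε * K * Fintype.card ι ≤
      ∑ k, (signVec (R k) ⬝ᵥ Q *ᵥ signVec (R k) - Q.trace)) :
    (T.card : ℝ) ≤ Fintype.card (Fin K → ι → ℤˣ) *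
      exp (-(ε ^ 2 * K * Fintype.card ι / 16)) := by
  set D : (ι → ℤˣ) → ℝ := fun r => signVec r ⬝ᵥ Q *ᵥ signVec r - Q.trace with hD
  -- `t = ε / 8` minimizes `4t² - εt`, with value `-ε²/16`; `ε ≤ 1` keeps `t` below `1/4`.
  have hmgf := sum_exp_quadForm_signVec_le Q hQ h0 h1 (t := ε / 8) (by positivity) (by linarith)
  have hprod := Finset.sum_prod_piFinset (Finset.univ : Finset (ι → ℤˣ))
    fun (_ : Fin K) r => exp (ε / 8 * D r)
  rw [Fintype.piFinset_univ, Finset.prod_const, Finset.card_univ, Fintype.card_fin] at hprod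
  have hmarkov : (T.card : ℝ) * exp (ε ^ 2 / 8 * K * Fintype.card ι) ≤
      (∑ r, exp (ε / 8 * D r)) ^ K := by
    rw [← hprod, ← nsmul_eq_mul, ← Finset.sum_const]
    calc ∑ _R ∈ T, exp (ε ^ 2 / 8 * K * Fintype.card ι)
        ≤ ∑ R ∈ T, ∏ k, exp (ε / 8 * D (R k)) := by
          refine Finset.sum_le_sum fun R hR => ?_
          rw [← exp_sum, ← Finset.mul_sum]
          refine exp_le_exp.mpr ?_
          nlinarith [mul_le_mul_of_nonneg_left (hT R hR) hε]
      _ ≤ _ := Finset.sum_le_sum_of_subset_of_nonneg (Finset.subset_univ _)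
          fun R _ _ => Finset.prod_nonneg fun _ _ => (exp_pos _).le
  have hpow := hmarkov.trans (pow_le_pow_left₀ (Finset.sum_nonneg fun _ _ => (exp_pos _).le) hmgf K)
  have hcard : (Fintype.card (Fin K → ι → ℤˣ) : ℝ) = (2 ^ Fintype.card ι) ^ K := by
    simp
  rw [hcard, ← mul_le_mul_iff_of_pos_right (exp_pos (ε ^ 2 / 8 * K * Fintype.card ι)),
    mul_assoc (_ ^ K), ← exp_add]
  refine hpow.trans_eq ?_
  rw [mul_pow, ← exp_nat_mul]
  ring_nf

/-- Two-sided tail of the sum of `K` independent copies of a Rademacher chaos. -/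
theorem card_le_abs_sum_quadForm_signVec (K : ℕ) (Q : Matrix ι ι ℝ) (hQ : Q.IsHermitian)
    (h0 : ∀ v, 0 ≤ v ⬝ᵥ Q *ᵥ v) (h1 : ∀ v, v ⬝ᵥ Q *ᵥ v ≤ v ⬝ᵥ v) {ε : ℝ} (hε : 0 ≤ ε)
    (hε' : ε ≤ 1) (T : Finset (Fin K → ι → ℤˣ))
    (hT : ∀ R ∈ T, ε * K * Fintype.card ι ≤
      |∑ k, (signVec (R k) ⬝ᵥ Q *ᵥ signVec (R k) - Q.trace)|) :
    (T.card : ℝ) ≤ Fintype.card (Fin K → ι → ℤˣ) *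
      (2 * exp (-(ε ^ 2 * K * Fintype.card ι / 16))) := by
  classical
  set P : (Fin K → ι → ℤˣ) → Prop := fun R => ε * K * Fintype.card ι ≤
      ∑ k, (signVec (R k) ⬝ᵥ Q *ᵥ signVec (R k) - Q.trace) with hP
  have hup := card_le_sum_quadForm_signVec K Q hQ h0 h1 hε hε' (T.filter P)
    fun R hR => (Finset.mem_filter.mp hR).2
  have hself : ∀ r : ι → ℤˣ, signVec r ⬝ᵥ signVec r = Fintype.card ι := fun r => by
    simp [dotProduct, signVec_mul_self]
  -- Since `r ⬝ᵥ r` equals the trace of 1, replacing `Q` by `1 - Q` flips the sign of the centered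
  -- form and preserves the bounds on `Q`.
  have hdown := card_le_sum_quadForm_signVec K (1 - Q) (Matrix.isHermitian_one.sub hQ)
    (fun v => by simpa [Matrix.sub_mulVec, dotProduct_sub] using h1 v)
    (fun v => by simpa [Matrix.sub_mulVec, dotProduct_sub] using h0 v) hε hε'
    (T.filter fun R => ¬ P R) fun R hR => by
      obtain ⟨hR, hn⟩ := Finset.mem_filter.mp hR
      have := (le_abs.mp (hT R hR)).resolve_left hn
      rw [← Finset.sum_neg_distrib] at this
      refine this.trans_eq (Finset.sum_congr rfl fun k _ => ?_)
      rw [Matrix.sub_mulVec, dotProduct_sub, Matrix.one_mulVec, hself, Matrix.trace_sub,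
        Matrix.trace_one]
      ring
  have hadd := Finset.card_filter_add_card_filter_not (s := T) P
  have : (T.card : ℝ) = (T.filter P).card + (T.filter fun R => ¬ P R).card := by
    exact_mod_cast hadd.symm
  linarith

end RademacherChaos

/-! ### Circuits as isometries and their output probabilities. -/

namespace OracleCircuit

variable {n : ℕ} (A : OracleCircuit n)

theorem phaseOracle_mem_unitaryGroup (f : A.Oracle) :
    A.phaseOracle f ∈ Matrix.unitaryGroup (Bits (n + A.a)) ℂ := by
  rw [Matrix.mem_unitaryGroup_iff, phaseOracle, Matrix.star_eq_conjTranspose,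
    Matrix.diagonal_conjTranspose, Matrix.diagonal_mul_diagonal, ← Matrix.diagonal_one]
  congr 1
  funext y
  rcases Int.units_eq_one_or (f fun i => y (Fin.castLE A.query_le i)) with h | h <;> simp [h]

theorem fullOp_mem_unitaryGroup (f : A.Oracle) :
    A.fullOp f ∈ Matrix.unitaryGroup (Bits (n + A.a)) ℂ := by
  refine mul_mem (A.U _).2 (list_prod_mem fun X hX => ?_)
  rw [List.mem_reverse, List.mem_ofFn] at hX
  obtain ⟨i, rfl⟩ := hX
  exact mul_mem (A.phaseOracle_mem_unitaryGroup f) (A.U _).2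

theorem ancillaInit_conjTranspose_mul_self : A.ancillaInitᴴ * A.ancillaInit = 1 := by
  ext x x'
  have hinj : Fin.append x' (fun _ : Fin A.a => false) = Fin.append x (fun _ => false) ↔
      x' = x := ⟨fun h => funext fun i => by simpa using congrFun h (Fin.castAdd A.a i),
    fun h => h ▸ rfl⟩
  simp [Matrix.mul_apply, ancillaInit, Matrix.one_apply, hinj, @eq_comm _ x' x]

theorem run_conjTranspose_mul_self (f : A.Oracle) : (A.run f)ᴴ * A.run f = 1 := by
  have h := Matrix.mem_unitaryGroup_iff'.mp (A.fullOp_mem_unitaryGroup f)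
  rw [Matrix.star_eq_conjTranspose] at h
  rw [run, Matrix.conjTranspose_mul, Matrix.mul_assoc, ← Matrix.mul_assoc _ (A.fullOp f), h,
    Matrix.one_mul, ancillaInit_conjTranspose_mul_self]

theorem _root_.Matrix.sum_norm_mulVec_sq {ι κ : Type*} [Fintype ι] [Fintype κ] [DecidableEq ι]
    {B : Matrix κ ι ℂ} (hB : Bᴴ * B = 1) (ψ : ι → ℂ) :
    ∑ y, ‖(B *ᵥ ψ) y‖ ^ 2 = ∑ x, ‖ψ x‖ ^ 2 := by
  have hn : ∀ {μ : Type _} [Fintype μ] (φ : μ → ℂ),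
      ((∑ y, ‖φ y‖ ^ 2 : ℝ) : ℂ) = star φ ⬝ᵥ φ := fun φ => by
    push_cast
    exact Finset.sum_congr rfl fun y _ => (Complex.conj_mul' _).symm
  apply Complex.ofReal_injective
  rw [hn, Matrix.star_mulVec, ← Matrix.dotProduct_mulVec, Matrix.mulVec_mulVec, hB,
    Matrix.one_mulVec]
  push_cast
  exact Finset.sum_congr rfl fun y _ => Complex.conj_mul' _

theorem outProb_false_add_true (f : A.Oracle) (ψ : Bits n → ℂ) :
    A.outProb f ψ false + A.outProb f ψ true = ∑ x, ‖ψ x‖ ^ 2 := by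
  rw [← Matrix.sum_norm_mulVec_sq (A.run_conjTranspose_mul_self f) ψ, outProb, outProb,
    ← Finset.sum_add_distrib]
  refine Finset.sum_congr rfl fun y _ => ?_
  cases y ⟨0, A.size_pos⟩ <;> simp

theorem outProb_nonneg (f : A.Oracle) (ψ : Bits n → ℂ) (b : Bool) : 0 ≤ A.outProb f ψ b :=
  Finset.sum_nonneg fun y _ => by split_ifs <;> positivity

theorem outProb_le (f : A.Oracle) (ψ : Bits n → ℂ) (b : Bool) :
    A.outProb f ψ b ≤ ∑ x, ‖ψ x‖ ^ 2 := by
  have h := A.outProb_false_add_true f ψ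
  have h0 := A.outProb_nonneg f ψ false
  have h1 := A.outProb_nonneg f ψ true
  cases b <;> linarith

/-! ### The advantage as a centered quadratic form. -/

/-- The real part of the measurement operator for the outcome `0` of `A^f`. -/
def acceptMatrix (f : A.Oracle) : Matrix (Bits n) (Bits n) ℝ :=
  let D : Matrix (Bits (n + A.a)) (Bits (n + A.a)) ℝ :=
    Matrix.diagonal fun y => if y ⟨0, A.size_pos⟩ = false then 1 else 0
  ((A.run f).map Complex.re)ᵀ * D * (A.run f).map Complex.re +
    ((A.run f).map Complex.im)ᵀ * D * (A.run f).map Complex.im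

theorem acceptMatrix_isHermitian (f : A.Oracle) : (A.acceptMatrix f).IsHermitian := by
  simp [Matrix.IsHermitian, acceptMatrix, Matrix.conjTranspose_eq_transpose_of_trivial,
    Matrix.transpose_mul, Matrix.mul_assoc]

theorem dotProduct_acceptMatrix_mulVec (f : A.Oracle) (v : Bits n → ℝ) :
    v ⬝ᵥ A.acceptMatrix f *ᵥ v = A.outProb f (fun x => (v x : ℂ)) false := by
  rw [acceptMatrix, Matrix.add_mulVec, dotProduct_add]
  simp only [← Matrix.mulVec_mulVec]
  rw [Matrix.dotProduct_mulVec v, Matrix.dotProduct_mulVec v, Matrix.vecMul_transpose,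
    Matrix.vecMul_transpose, outProb, dotProduct, dotProduct, ← Finset.sum_add_distrib]
  refine Finset.sum_congr rfl fun y _ => ?_
  have hre : ((A.run f *ᵥ fun x => (v x : ℂ)) y).re = ((A.run f).map Complex.re *ᵥ v) y := by
    simp [Matrix.mulVec, dotProduct]
  have him : ((A.run f *ᵥ fun x => (v x : ℂ)) y).im = ((A.run f).map Complex.im *ᵥ v) y := by
    simp [Matrix.mulVec, dotProduct]
  rw [Matrix.mulVec_diagonal, Matrix.mulVec_diagonal, Complex.sq_norm, Complex.normSq_apply, hre,
    him]
  split_ifs <;> ring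

theorem dotProduct_acceptMatrix_mulVec_nonneg (f : A.Oracle) (v : Bits n → ℝ) :
    0 ≤ v ⬝ᵥ A.acceptMatrix f *ᵥ v := by
  rw [dotProduct_acceptMatrix_mulVec]
  exact A.outProb_nonneg _ _ _

theorem dotProduct_acceptMatrix_mulVec_le (f : A.Oracle) (v : Bits n → ℝ) :
    v ⬝ᵥ A.acceptMatrix f *ᵥ v ≤ v ⬝ᵥ v := by
  rw [dotProduct_acceptMatrix_mulVec]
  refine (A.outProb_le _ _ _).trans_eq (Finset.sum_congr rfl fun x _ => ?_)
  rw [Complex.norm_real, Real.norm_eq_abs, sq_abs, sq]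

theorem outProb_phaseState (f : A.Oracle) (h : BoolFn n) :
    A.outProb f (phaseState h) false = (signVec h ⬝ᵥ A.acceptMatrix f *ᵥ signVec h) / 2 ^ n := by
  have hs : phaseState h = fun x => (((1 / √((2 : ℝ) ^ n)) • signVec h) x : ℂ) := by
    funext x
    simp [phaseState, signVec]
  rw [hs, ← dotProduct_acceptMatrix_mulVec, Matrix.mulVec_smul, dotProduct_smul, smul_dotProduct,
    smul_eq_mul, smul_eq_mul, ← mul_assoc, div_mul_div_comm, Real.mul_self_sqrt (by positivity)]
  ring

theorem outProb_single (f : A.Oracle) (x : Bits n) :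
    A.outProb f (Pi.single x 1) true = 1 - A.acceptMatrix f x x := by
  have hs : (Pi.single x 1 : Bits n → ℂ) = fun z => ((Pi.single x 1 : Bits n → ℝ) z : ℂ) := by
    funext z
    by_cases h : z = x <;> simp [h]
  have h := A.outProb_false_add_true f (Pi.single x 1)
  have h1 : ∑ z, ‖(Pi.single x 1 : Bits n → ℂ) z‖ ^ 2 = 1 := by
    rw [Finset.sum_eq_single x] <;> simp +contextual
  have h2 : A.outProb f (Pi.single x 1) false = A.acceptMatrix f x x := by
    rw [hs, ← dotProduct_acceptMatrix_mulVec]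
    simp
  linarith

theorem advantage_eq {K : ℕ} (hK : 0 < K) (R : FnFamily K n) (f : A.Oracle) :
    A.advantage R f = |∑ k, (signVec (R k) ⬝ᵥ A.acceptMatrix f *ᵥ signVec (R k) -
      (A.acceptMatrix f).trace)| / (K * 2 ^ n) := by
  have hK' : (0 : ℝ) < K := by exact_mod_cast hK
  have hx : (𝔼 x : Bits n, A.outProb f (Pi.single x 1) true) =
      1 - (A.acceptMatrix f).trace / 2 ^ n := by
    simp_rw [outProb_single]
    rw [Fintype.expect_eq_sum_div_card, Finset.sum_sub_distrib, Matrix.trace]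
    simp [sub_div]
  have hk : (𝔼 k : Fin K, A.outProb f (phaseState (R k)) false) =
      (∑ k, signVec (R k) ⬝ᵥ A.acceptMatrix f *ᵥ signVec (R k)) / 2 ^ n / K := by
    simp_rw [outProb_phaseState]
    rw [Fintype.expect_eq_sum_div_card, Fintype.card_fin, Finset.sum_div]
    simp_rw [Finset.sum_div]
  rw [advantage, winProb, hx, hk, Finset.sum_sub_distrib, Finset.sum_const, Finset.card_univ,
    Fintype.card_fin, nsmul_eq_mul]
  nth_rewrite 1 [← abs_two]
  rw [← abs_mul, ← abs_of_pos (by positivity : (0 : ℝ) < K * 2 ^ n), ← abs_div]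
  congr 1
  field_simp
  ring

theorem sum_norm_phaseState_sq (h : BoolFn n) : ∑ x, ‖phaseState h x‖ ^ 2 = 1 := by
  have : ∀ x, ‖phaseState h x‖ ^ 2 = 1 / 2 ^ n := fun x => by
    rcases Int.units_eq_one_or (h x) with hx | hx <;>
      simp [phaseState, hx, inv_pow, sq_abs]
  simp_rw [this]
  simp

theorem advantage_le_one {K : ℕ} (hK : 0 < K) (R : FnFamily K n) (f : A.Oracle) :
    A.advantage R f ≤ 1 := by
  have : Nonempty (Fin K) := ⟨⟨0, hK⟩⟩
  have e : ∀ {ι : Type} [Fintype ι] [Nonempty ι] (p : ι → ℝ), (∀ i, 0 ≤ p i) → (∀ i, p i ≤ 1) →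
      0 ≤ (𝔼 i, p i) ∧ (𝔼 i, p i) ≤ 1 := fun p h0 h1 =>
    ⟨Finset.expect_nonneg fun i _ => h0 i,
      Finset.expect_le Finset.univ_nonempty fun i _ => h1 i⟩
  obtain ⟨h1, h2⟩ := e (fun k => A.outProb f (phaseState (R k)) false)
    (fun _ => A.outProb_nonneg _ _ _)
    fun k => (A.outProb_le _ _ _).trans_eq (sum_norm_phaseState_sq (R k))
  obtain ⟨h3, h4⟩ := e (fun x : Bits n => A.outProb f (Pi.single x 1) true)
    (fun _ => A.outProb_nonneg _ _ _)
    fun x => (A.outProb_le _ _ _).trans_eq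
      (by rw [Finset.sum_eq_single x] <;> simp +contextual)
  have : |A.winProb R f - 1 / 2| ≤ 1 / 2 := by
    rw [abs_le, winProb]
    constructor <;> linarith
  rw [advantage]
  linarith

theorem advantage_eq_of_run_eq {K : ℕ} (R : FnFamily K n) {f g : A.Oracle}
    (h : A.run f = A.run g) : A.advantage R f = A.advantage R g := by
  simp only [advantage, winProb, outProb, h]

/-- For `N = 1` the form is a scalar times a squared sign, hence equal to its trace. -/
theorem advantage_eq_zero (hn : n = 0) {K : ℕ} (hK : 0 < K) (R : FnFamily K n) (f : A.Oracle) :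
    A.advantage R f = 0 := by
  subst hn
  rw [advantage_eq A hK, Finset.sum_eq_zero, abs_zero, zero_div]
  intro k _
  simp only [dotProduct, Matrix.mulVec, Matrix.trace, Matrix.diag_apply,
    Fintype.sum_subsingleton _ (default : Bits 0)]
  linear_combination A.acceptMatrix f default default * signVec_mul_self (R k) default

/-! ### Union bound over oracle behaviours, and counting them. -/

/-- The concentration bound for adversaries whose advantage depends on the oracle `f` only through
some `g f` that takes at most `S` values. -/
theorem probAdvantageGE_le {β : Type*} (g : A.Oracle → β) {K : ℕ} (hK : 0 < K) {ε : ℝ}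
    (hε : 0 ≤ ε)
    (hg : ∀ f f', g f = g f' → ∀ R : FnFamily K n, A.advantage R f = A.advantage R f')
    (hS : ((Set.range g).ncard : ℝ) ≤ Real.exp (1 / 32 * ε ^ 2 * K * 2 ^ n)) :
    A.probAdvantageGE K ε ≤ 2 * Real.exp (-(1 / 32 * ε ^ 2 * K * 2 ^ n)) := by
  classical
  set T : Finset (FnFamily K n) := Finset.univ.filter fun R => ε ≤ A.maxAdvantage R with hT
  have hprob : A.probAdvantageGE K ε = (T.card : ℝ) / Fintype.card (FnFamily K n) := by
    rw [probAdvantageGE, Finset.dens_eq_card_div_card, hT]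
    push_cast
    congr!
  rw [hprob]
  by_cases hε' : ε ≤ 1
  swap
  -- For `ε > 1` the event is empty, as advantages never exceed 1.
  · have hT0 : T = ∅ := Finset.filter_eq_empty_iff.mpr fun R _ => by
      have : A.maxAdvantage R ≤ 1 := Finset.sup'_le _ _ fun f _ => A.advantage_le_one hK R f
      linarith
    rw [hT0, Finset.card_empty, Nat.cast_zero, zero_div]
    positivity
  choose rep hrep using fun v : Set.range g => v.2
  have : Fintype (Set.range g) := Fintype.ofFinite _
  -- One representative oracle per value of `g` suffices, so the union has at most `S` members.
  have hsub : T ⊆ Finset.univ.biUnion fun v : Set.range g =>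
      Finset.univ.filter fun R => ε ≤ A.advantage R (rep v) := fun R hR => by
    obtain ⟨f, -, hf⟩ := (Finset.le_sup'_iff _).mp (Finset.mem_filter.mp hR).2
    refine Finset.mem_biUnion.mpr ⟨⟨g f, f, rfl⟩, Finset.mem_univ _,
      Finset.mem_filter.mpr ⟨Finset.mem_univ _, ?_⟩⟩
    rwa [hg _ f (hrep ⟨g f, f, rfl⟩) R]
  have hone : ∀ v : Set.range g,
      ((Finset.univ.filter fun R : FnFamily K n => ε ≤ A.advantage R (rep v)).card : ℝ) ≤
        Fintype.card (FnFamily K n) * (2 * Real.exp (-(ε ^ 2 * K * 2 ^ n / 16))) := fun v => by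
    have h := card_le_abs_sum_quadForm_signVec K (A.acceptMatrix (rep v))
      (A.acceptMatrix_isHermitian _) (A.dotProduct_acceptMatrix_mulVec_nonneg _)
      (A.dotProduct_acceptMatrix_mulVec_le _) hε hε'
      (Finset.univ.filter fun R : FnFamily K n => ε ≤ A.advantage R (rep v)) fun R hR => by
        have := (Finset.mem_filter.mp hR).2
        have hK' : (0 : ℝ) < K := by exact_mod_cast hK
        rw [A.advantage_eq hK, le_div_iff₀ (by positivity)] at this
        simpa [mul_assoc] using this
    simpa using h
  have hcard : (Fintype.card (Set.range g) : ℝ) ≤ Real.exp (1 / 32 * ε ^ 2 * K * 2 ^ n) := by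
    rwa [← Nat.card_eq_fintype_card, Nat.card_coe_set_eq]
  rw [div_le_iff₀ (by exact_mod_cast Fintype.card_pos)]
  calc (T.card : ℝ) ≤ ∑ v : Set.range g,
        ((Finset.univ.filter fun R : FnFamily K n => ε ≤ A.advantage R (rep v)).card : ℝ) := by
        exact_mod_cast (Finset.card_le_card hsub).trans Finset.card_biUnion_le
    _ ≤ Fintype.card (Set.range g) *
        (Fintype.card (FnFamily K n) * (2 * Real.exp (-(ε ^ 2 * K * 2 ^ n / 16)))) := by
        refine (Finset.sum_le_sum fun v _ => hone v).trans_eq ?_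
        rw [Finset.sum_const, Finset.card_univ, nsmul_eq_mul]
    _ ≤ Real.exp (1 / 32 * ε ^ 2 * K * 2 ^ n) *
        (Fintype.card (FnFamily K n) * (2 * Real.exp (-(ε ^ 2 * K * 2 ^ n / 16)))) := by
        gcongr
    _ = 2 * Real.exp (-(1 / 32 * ε ^ 2 * K * 2 ^ n)) * Fintype.card (FnFamily K n) := by
        rw [mul_left_comm, mul_left_comm _ (2 : ℝ), ← Real.exp_add]
        ring_nf

theorem sum_append {a : ℕ} {M : Type*} [AddCommMonoid M] (F : Bits (n + a) → M) :
    ∑ y, F y = ∑ x : Bits n, ∑ z : Bits a, F (Fin.append x z) := by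
  rw [← Fintype.sum_prod_type', ← (Fin.appendEquiv n a).sum_comp]
  rfl

/-- If `A^f` exactly computes `V` on its first `n ≥ 1` qubits, then its output statistics are those
of `V`. -/
theorem outProb_eq_of_exactlyComputes (hn : 0 < n) (f : A.Oracle)
    (V : Matrix.unitaryGroup (Bits n) ℂ) (junk : Bits A.a → ℂ)
    (h : ∀ (ψ : Bits n → ℂ) (x : Bits n) (z : Bits A.a), (A.run f *ᵥ ψ) (Fin.append x z) =
      ((V : Matrix (Bits n) (Bits n) ℂ) *ᵥ ψ) x * junk z) (ψ : Bits n → ℂ) (b : Bool) :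
    A.outProb f ψ b = ∑ x : Bits n, if x ⟨0, hn⟩ = b then
      ‖((V : Matrix (Bits n) (Bits n) ℂ) *ᵥ ψ) x‖ ^ 2 else 0 := by
  have hV : (V : Matrix (Bits n) (Bits n) ℂ)ᴴ * V = 1 := Matrix.mem_unitaryGroup_iff'.mp V.2
  -- Both `A.run f` and `V` preserve norms, so comparing them on a single basis state normalizes the
  -- junk.
  have hjunk : ∑ z, ‖junk z‖ ^ 2 = 1 := by
    let x₀ : Bits n := fun _ => false
    have hsingle : ∑ z, ‖(Pi.single x₀ 1 : Bits n → ℂ) z‖ ^ 2 = 1 := by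
      rw [Finset.sum_eq_single x₀] <;> simp +contextual
    have h1 := Matrix.sum_norm_mulVec_sq (A.run_conjTranspose_mul_self f) (Pi.single x₀ 1)
    have h2 := Matrix.sum_norm_mulVec_sq hV (Pi.single x₀ 1)
    rw [hsingle] at h1 h2
    rw [sum_append] at h1
    simp_rw [h, norm_mul, mul_pow, ← Finset.mul_sum] at h1
    rwa [← Finset.sum_mul, h2, one_mul] at h1
  rw [outProb, sum_append]
  refine Finset.sum_congr rfl fun x _ => ?_
  have h0 : ∀ z : Bits A.a, Fin.append x z ⟨0, A.size_pos⟩ = x ⟨0, hn⟩ := fun z =>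
    Fin.append_left x z ⟨0, hn⟩
  simp_rw [h0, h, norm_mul, mul_pow]
  split_ifs
  · rw [← Finset.mul_sum, hjunk, mul_one]
  · simp

theorem isSmall_two_pow : A.IsSmall (2 ^ 2 ^ (n + A.a)) := by
  have h : (Set.range A.run).ncard ≤ 2 ^ 2 ^ A.ℓ := by
    rw [← Set.image_univ]
    refine (Set.ncard_image_le Set.finite_univ).trans_eq ?_
    simp [Set.ncard_univ, Nat.card_eq_fintype_card]
  refine (Nat.cast_le.mpr h).trans ?_
  push_cast
  exact pow_le_pow_right₀ one_le_two (pow_le_pow_right₀ one_le_two A.query_le)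

end OracleCircuit

end

theorem mainTheorem7 :
    ∃ c : ℝ, 0 < c ∧
      ∀ (K n : ℕ) (ε : ℝ) (A : OracleCircuit n), 0 < K → 0 ≤ ε →
        (A.IsSmall (Real.exp (c * ε ^ 2 * K * 2 ^ n)) →
          A.probAdvantageGE K ε ≤ 2 * Real.exp (-(c * ε ^ 2 * K * 2 ^ n))) ∧
        (A.ExactlyComputesAtMost (Real.exp (c * ε ^ 2 * K * 2 ^ n)) →
          A.probAdvantageGE K ε ≤ 2 * Real.exp (-(c * ε ^ 2 * K * 2 ^ n))) ∧
        A.IsSmall (2 ^ 2 ^ (n + A.a)) := by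
  -- Half of the tail constant `1/16`: the union bound spends one half and the other remains.
  refine ⟨1 / 32, by norm_num, fun K n ε A hK hε => ⟨fun h => ?_, ?_, A.isSmall_two_pow⟩⟩
  · exact A.probAdvantageGE_le A.run hK hε (fun _ _ h R => A.advantage_eq_of_run_eq R h) h
  · rintro ⟨V, junk, hV, hS⟩
    refine A.probAdvantageGE_le V hK hε (fun f f' hff R => ?_) hS
    rcases Nat.eq_zero_or_pos n with hn | hn
    -- With `n = 0` the measured qubit is an ancilla, so `V` does not determine the statistics, but
    -- every advantage vanishes.
    · rw [A.advantage_eq_zero hn hK, A.advantage_eq_zero hn hK]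
    · have e := fun f => A.outProb_eq_of_exactlyComputes hn f (V f) (junk f) (hV f)
      simp only [OracleCircuit.advantage, OracleCircuit.winProb, e, hff]
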